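/- Let $\langle\mathcal S,\mathcal A,T,R,\gamma\rangle$ be a Markov decision process with finite state space $\mathcal S$, finite action space $\mathcal A$ containing a no-op action $\varnothing$, transition function $T$, reward function $R:\mathcal S\times\mathcal A\to\mathbb R$ and discount factor $\gamma\in[0,1)$. Let $\lambda\ge 0$ and let $R_1,\dots,R_k:\mathcal S\times\mathcal A\to\mathbb R$ be finitely many auxiliary reward functions. An agent interacts with the process: at step $n=0,1,2,\dots$ it is in state $s_n$, takes action $a_n$ and observes a successor $s'_n$ which, conditionally on the information $\mathcal F_n$ (a filtration, with $s'_n$ being $\mathcal F_{n+1}$-measurable) available once $a_n$ has been selected (including $s_n$ and $a_n$), has law $T(s_n,a_n)$. Actions may depend on the past in any way, and either $s_{n+1}=s'_n$ or the next state may be reset, as in episodic learning. It runs tabular Q-learning on all auxiliary rewards simultaneously: from arbitrary initial tables $Q^0_{R_i}$, $$Q^{n+1}_{R_i}(s_n,a_n)=Q^n_{R_i}(s_n,a_n)+\alpha_n\Big(R_i(s_n,a_n)+\gamma\max_{a'}Q^n_{R_i}(s'_n,a')-Q^n_{R_i}(s_n,a_n)\Big),$$ all other entries being unchanged. Assume that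 almost surely every state-action pair is tried infinitely often, and that the learning rates $\alpha_n\ge 0$ are $\mathcal F_n$-measurable and almost surely satisfy, for every $(s,a)$, $$\sum_{n:(s_n,a_n)=(s,a)}\alpha_n=\infty,\qquad \sum_{n:(s_n,a_n)=(s,a)}\alpha_n^2<\infty .$$ (In particular, the exploration policy may be any policy that is greedy in the limit of infinite exploration.) Put $\mathrm{Penalty}_n(s,a)=\sum_{i=1}^k|Q^n_{R_i}(s,a)-Q^n_{R_i}(s,\varnothing)|$, let $\mathrm{Scale}_n(s)$ be a normalization computed from the tables $Q^n_{R_1},\dots,Q^n_{R_k}$ (for example $\sum_i Q^n_{R_i}(s,\varnothing)$), and let $$R^n_{\mathrm{AUP}}(s,a)=R(s,a)-\lambda\,\frac{\mathrm{Penalty}_n(s,a)}{\mathrm{Scale}_n(s)} .$$ Suppose that, almost surely, for every $s$, $\mathrm{Scale}_n(s)$ converges as $n\to\infty$ to a limit $\mathrm{Scale}^*(s)>0$. Then, with probability $1$, for all $s,a$ the online AUP reward $R^n_{\mathrm{AUP}}(s,a)$ converges as $n\to\infty$; its limit is $$R^*_{\mathrm{AUP}}(s,a)=R(s,a)-\lambda\,\frac{\sum_{i=1}^k|Q^*_{R_i}(s,a)-Q^*_{R_i}(s,\varnothing)|}{\mathrm{Scale}^*(s)},$$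 where $Q^*_{R_i}$ is the optimal Q-function of $\langle\mathcal S,\mathcal A,T,R_i,\gamma\rangle$, i.e. the solution of $Q(s,a)=R_i(s,a)+\gamma\sum_{s'}T(s'\mid s,a)\max_{a'}Q(s',a')$. -/

import Mathlib

open MeasureTheory Filter Topology

namespace AUP

/-- The expected value of `f` at the successor state of `(s, a)`, for a finite state space. -/
noncomputable def expectNext {S A : Type*} [Fintype S] (T : S → A → PMF S) (s : S) (a : A)
    (f : S → ℝ) : ℝ :=
  ∑ s', (T s a s').toReal * f s'

/-- `q` is the optimal Q-function of the MDP `(S, A, T, r, γ)`, i.e. it solves the Bellman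
optimality equation (which has exactly one solution when `S`, `A` are finite, `A` is non-empty and
`0 ≤ γ < 1`). -/
def IsOptimalQ {S A : Type*} [Fintype S] (T : S → A → PMF S) (γ : ℝ) (r : S → A → ℝ)
    (q : S → A → ℝ) : Prop :=
  ∀ s a, q s a = r s a + γ * expectNext T s a (fun s' => ⨆ a', q s' a')

/-- One tabular Q-learning update on the transition `(s, a, s')` with learning rate `η`:
`q(s,a) += η (r(s,a) + γ max_{a'} q(s',a') - q(s,a))`; the other entries do not change. -/
noncomputable def qUpdate {S A : Type*} [DecidableEq S] [DecidableEq A] (γ : ℝ) (r : S → A → ℝ)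
    (η : ℝ) (s : S) (a : A) (s' : S) (q : S → A → ℝ) : S → A → ℝ :=
  fun x b =>
    if x = s ∧ b = a then q x b + η * ((r x b + γ * ⨆ a', q s' a') - q x b) else q x b

/-- The Q-table of the learner of the reward `r`, started at `q₀`, after the first `n` transitions
`(X k ω, U k ω, Y k ω)`, `k < n`, processed with learning rates `α k ω`. -/
noncomputable def qLearn {Ω S A : Type*} [DecidableEq S] [DecidableEq A] (γ : ℝ)
    (X : ℕ → Ω → S) (U : ℕ → Ω → A) (Y : ℕ → Ω → S) (α : ℕ → Ω → ℝ)
    (r : S → A → ℝ) (q₀ : S → A → ℝ) : ℕ → Ω → S → A → ℝ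
  | 0, _ => q₀
  | n + 1, ω =>
      qUpdate γ r (α n ω) (X n ω) (U n ω) (Y n ω) (qLearn γ X U Y α r q₀ n ω)

/-- The AUP penalty of action `a` in state `s`, relative to the auxiliary Q-functions `Q`. -/
noncomputable def penalty {ι S A : Type*} [Fintype ι] (noop : A) (Q : ι → S → A → ℝ)
    (s : S) (a : A) : ℝ :=
  ∑ i, |Q i s a - Q i s noop|

/-- The AUP reward, relative to the auxiliary Q-functions `Q`. The normalization `scale` is chosen
by the designer: it turns the auxiliary Q-functions into a function of the state, as in
`fun Q s => ∑ i, Q i s noop` or, for a mild action `m`, `fun Q s => penalty noop Q s m`. -/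
noncomputable def rAUP {ι S A : Type*} [Fintype ι] (noop : A) (R : S → A → ℝ) (lam : ℝ)
    (scale : (ι → S → A → ℝ) → S → ℝ) (Q : ι → S → A → ℝ) (s : S) (a : A) : ℝ :=
  R s a - lam * (penalty noop Q s a / scale Q s)

/-- Experience gathered in an MDP with transition function `T`. At step `n` the agent is in state
`X n`, takes action `U n` and observes the successor `Y n`. The σ-algebra `ℱ n` is the information
available once `U n` has been selected, and given it `Y n` has law `T (X n) (U n)`. The action rule
may depend on the past in any way. A single trajectory is the case `X (n + 1) = Y n`; leaving
`X (n + 1)` free also allows for episodes with resets. -/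
structure IsExperience {Ω S A : Type*} {mΩ : MeasurableSpace Ω} (μ : Measure Ω)
    (ℱ : Filtration ℕ mΩ) (T : S → A → PMF S)
    (X : ℕ → Ω → S) (U : ℕ → Ω → A) (Y : ℕ → Ω → S) : Prop where
  state_adapted : ∀ n s, MeasurableSet[ℱ n] {ω | X n ω = s}
  action_adapted : ∀ n a, MeasurableSet[ℱ n] {ω | U n ω = a}
  next_adapted : ∀ n s', MeasurableSet[ℱ (n + 1)] {ω | Y n ω = s'}
  transition : ∀ n s',
    μ[{ω | Y n ω = s'}.indicator (fun _ => (1 : ℝ)) | ℱ n]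
      =ᵐ[μ] fun ω => (T (X n ω) (U n ω) s').toReal

/-- Infinite exploration: almost surely every state-action pair is tried infinitely often. -/
def ExploresInfinitely {Ω S A : Type*} {mΩ : MeasurableSpace Ω} (μ : Measure Ω)
    (X : ℕ → Ω → S) (U : ℕ → Ω → A) : Prop :=
  ∀ᵐ ω ∂μ, ∀ s a, ∃ᶠ n in atTop, X n ω = s ∧ U n ω = a

/-- A learning rate schedule: non-negative rates, known before the successor is observed, which
along the visits to each state-action pair almost surely have infinite sum and finite sum of
squares. -/
structure IsLearningRate {Ω S A : Type*} [DecidableEq S] [DecidableEq A] {mΩ : MeasurableSpace Ω}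
    (μ : Measure Ω) (ℱ : Filtration ℕ mΩ) (X : ℕ → Ω → S) (U : ℕ → Ω → A)
    (α : ℕ → Ω → ℝ) : Prop where
  nonneg : ∀ n ω, 0 ≤ α n ω
  adapted : ∀ n, Measurable[ℱ n] (α n)
  sum_infinite : ∀ᵐ ω ∂μ, ∀ s a, Tendsto
    (fun N => ∑ n ∈ Finset.range N, if X n ω = s ∧ U n ω = a then α n ω else 0) atTop atTop
  sum_sq_finite : ∀ᵐ ω ∂μ, ∀ s a,
    Summable (fun n => if X n ω = s ∧ U n ω = a then α n ω ^ 2 else 0)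

end AUP

/-! The AUP reward is continuous in the auxiliary tables and in the scale, whose limit is positive,
so everything rests on almost sure convergence of Q-learning for one reward.

Subtract the Bellman equation of the optimal table from an update. On visits to a fixed pair the
error is averaged, with the learning rate as weight, against `γ` times an expected difference of
maxima, plus sampling noise. If all errors are eventually at most `D`, the averaged term is at most
`γ * D`. The rates have infinite sum, so the start is forgotten, and noise with convergent partial
sums does not matter in the limit. Hence the errors are eventually at most `γ * D + ε`; iterating
drives them to zero (`tendsto_of_tendsto_noise`).

Only the noise involves probability. For each successor it is a transform of bounded martingale
differences whose coefficients are a rate times a maximum of the current table. The tables stay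
bounded along each path, so the squared coefficients are summable, and a localized L² martingale
argument (`ae_exists_tendsto_transform`) gives convergence. -/

namespace AUP

/-! ### Deterministic averaging recursions -/

/-- An averaging recursion with non-summable step sizes forgets its starting point. -/
theorem eventually_abs_le_of_averaging {y g a : ℕ → ℝ} {D ε : ℝ}
    (ha0 : ∀ n, 0 ≤ a n) (ha1 : ∀ᶠ n in atTop, a n ≤ 1)
    (hsum : Tendsto (fun N => ∑ n ∈ Finset.range N, a n) atTop atTop)
    (hy : ∀ n, y (n + 1) = (1 - a n) * y n + a n * g n)
    (hg : ∀ᶠ n in atTop, |g n| ≤ D) (hε : 0 < ε) :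
    ∀ᶠ n in atTop, |y n| ≤ D + ε := by
  obtain ⟨N, hN⟩ := eventually_atTop.1 (ha1.and hg)
  set σ : ℕ → ℝ := fun n => ∑ k ∈ Finset.range n, a k with hσ
  have hD : 0 ≤ D := (abs_nonneg _).trans (hN N le_rfl).2
  -- The initial value is damped by the product of the `1 - a k`, which `1 - t ≤ exp (-t)` bounds by
  -- the exponential of minus the accumulated steps.
  have key : ∀ n, N ≤ n → |y n| ≤ D + |y N| * Real.exp (-(σ n - σ N)) := by
    intro n hn
    induction n, hn using Nat.le_induction with
    | base => simp [hD]
    | succ n hn ih =>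
      obtain ⟨h1, h2⟩ := hN n hn
      have h3 : 0 ≤ 1 - a n := by linarith
      have hexp : 1 - a n ≤ Real.exp (-a n) := by
        have := Real.add_one_le_exp (-a n); linarith
      have hs : σ (n + 1) = σ n + a n := Finset.sum_range_succ _ _
      calc |y (n + 1)| ≤ |(1 - a n) * y n| + |a n * g n| := by rw [hy]; exact abs_add_le _ _
        _ = (1 - a n) * |y n| + a n * |g n| := by
          rw [abs_mul, abs_mul, abs_of_nonneg h3, abs_of_nonneg (ha0 n)]
        _ ≤ (1 - a n) * (D + |y N| * Real.exp (-(σ n - σ N))) + a n * D :=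
          add_le_add (mul_le_mul_of_nonneg_left ih h3) (mul_le_mul_of_nonneg_left h2 (ha0 n))
        _ = D + |y N| * ((1 - a n) * Real.exp (-(σ n - σ N))) := by ring
        _ ≤ D + |y N| * (Real.exp (-a n) * Real.exp (-(σ n - σ N))) := by gcongr
        _ = D + |y N| * Real.exp (-(σ (n + 1) - σ N)) := by
          rw [← Real.exp_add, hs]; ring_nf
  have hlim : Tendsto (fun n => |y N| * Real.exp (-(σ n - σ N))) atTop (𝓝 0) := by
    have h := (Real.tendsto_exp_neg_atTop_nhds_zero.comp
      (tendsto_atTop_add_const_right atTop (-σ N) hsum)).const_mul |y N|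
    simpa [Function.comp_def, sub_eq_add_neg] using h
  filter_upwards [eventually_ge_atTop N, hlim.eventually (gt_mem_nhds hε)] with n hn h
  exact (key n hn).trans (by linarith)

/-- Additive noise with convergent partial sums does not affect the asymptotic bound of an
averaging recursion. -/
theorem eventually_abs_le_of_noisy_averaging {x f a e : ℕ → ℝ} {D E ε : ℝ}
    (ha0 : ∀ n, 0 ≤ a n) (ha1 : ∀ᶠ n in atTop, a n ≤ 1)
    (hsum : Tendsto (fun N => ∑ n ∈ Finset.range N, a n) atTop atTop)
    (hx : ∀ n, x (n + 1) = (1 - a n) * x n + a n * f n + e n)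
    (he : Tendsto (fun N => ∑ n ∈ Finset.range N, e n) atTop (𝓝 E))
    (hf : ∀ᶠ n in atTop, |f n| ≤ D) (hε : 0 < ε) :
    ∀ᶠ n in atTop, |x n| ≤ D + ε := by
  -- `δ` is minus the remaining noise. Since `δ (n + 1) = δ n + e n`, the sequence `x - δ` obeys a
  -- noise-free recursion with target `f - δ`.
  set δ : ℕ → ℝ := fun n => (∑ k ∈ Finset.range n, e k) - E with hδ
  have hδ0 : Tendsto δ atTop (𝓝 0) := by simpa using he.sub_const E
  have hδε : ∀ᶠ n in atTop, |δ n| < ε / 3 := by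
    have := hδ0.abs
    rw [abs_zero] at this
    exact this.eventually (gt_mem_nhds (by positivity))
  have hy : ∀ n, x (n + 1) - δ (n + 1) = (1 - a n) * (x n - δ n) + a n * (f n - δ n) := by
    intro n
    have : δ (n + 1) = δ n + e n := by simp only [hδ, Finset.sum_range_succ]; ring
    rw [hx, this]; ring
  have hg : ∀ᶠ n in atTop, |f n - δ n| ≤ D + ε / 3 := by
    filter_upwards [hf, hδε] with n h1 h2
    exact (abs_sub _ _).trans (by linarith)
  filter_upwards [hδε, eventually_abs_le_of_averaging (y := fun n => x n - δ n) ha0 ha1 hsum hy hg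
    (show 0 < ε / 3 by positivity)] with n h1 h2
  calc |x n| = |(x n - δ n) + δ n| := by ring_nf
    _ ≤ |x n - δ n| + |δ n| := abs_add_le _ _
    _ ≤ D + ε := by linarith

/-! ### The Bellman operator -/

section Bellman

variable {S A : Type*}

theorem abs_iSup_sub_iSup_le [Fintype A] [Nonempty A] {f g : A → ℝ} {D : ℝ}
    (h : ∀ a, |f a - g a| ≤ D) : |(⨆ a, f a) - ⨆ a, g a| ≤ D := by
  have aux : ∀ {f g : A → ℝ}, (∀ a, |f a - g a| ≤ D) → (⨆ a, f a) ≤ (⨆ a, g a) + D := by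
    intro f g h
    refine ciSup_le fun a => ?_
    have h1 := (abs_le.1 (h a)).2
    have h2 := le_ciSup (Set.finite_range g).bddAbove a
    linarith
  have h1 := aux h
  have h2 := aux (f := g) (g := f) fun a => by rw [abs_sub_comm]; exact h a
  exact abs_le.2 ⟨by linarith, by linarith⟩

theorem abs_iSup_le [Fintype A] [Nonempty A] {f : A → ℝ} {D : ℝ}
    (h : ∀ a, |f a| ≤ D) : |⨆ a, f a| ≤ D := by
  simpa using abs_iSup_sub_iSup_le (g := fun _ : A => (0 : ℝ)) (by simpa using h)

variable [Fintype S]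

theorem sum_toReal_eq_one (p : PMF S) : ∑ s, (p s).toReal = 1 := by
  rw [← ENNReal.toReal_sum fun s _ => p.apply_ne_top s, ← tsum_fintype (L := .unconditional S),
    p.tsum_coe, ENNReal.toReal_one]

theorem expectNext_sub (T : S → A → PMF S) (s : S) (a : A) (f g : S → ℝ) :
    expectNext T s a f - expectNext T s a g = expectNext T s a (fun s' => f s' - g s') := by
  simp only [expectNext, ← Finset.sum_sub_distrib, mul_sub]

theorem abs_expectNext_le (T : S → A → PMF S) (s : S) (a : A) {f : S → ℝ} {D : ℝ}
    (h : ∀ s', |f s'| ≤ D) : |expectNext T s a f| ≤ D := by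
  calc |expectNext T s a f| ≤ ∑ s', |(T s a s').toReal * f s'| := Finset.abs_sum_le_sum_abs _ _
    _ ≤ ∑ s', (T s a s').toReal * D := by
      refine Finset.sum_le_sum fun s' _ => ?_
      rw [abs_mul, abs_of_nonneg ENNReal.toReal_nonneg]
      exact mul_le_mul_of_nonneg_left (h s') ENNReal.toReal_nonneg
    _ = D := by rw [← Finset.sum_mul, sum_toReal_eq_one, one_mul]

/-- Maxima and expectations are 1-Lipschitz in the sup norm, so the Bellman operator is a
`γ`-contraction and Banach's theorem applies. -/
theorem exists_isOptimalQ [Fintype A] [Nonempty A] (T : S → A → PMF S) {γ : ℝ} (hγ0 : 0 ≤ γ) (hγ1 : γ < 1)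
    (r : S → A → ℝ) : ∃ q, IsOptimalQ T γ r q := by
  let B : (S → A → ℝ) → (S → A → ℝ) :=
    fun q s a => r s a + γ * expectNext T s a (fun s' => ⨆ a', q s' a')
  have hB : ContractingWith ⟨γ, hγ0⟩ B := by
    refine ⟨by exact_mod_cast hγ1, LipschitzWith.of_dist_le_mul fun q q' => ?_⟩
    have hnn : 0 ≤ γ * dist q q' := mul_nonneg hγ0 dist_nonneg
    refine (dist_pi_le_iff hnn).2 fun s => (dist_pi_le_iff hnn).2 fun a => ?_
    simp only [B, Real.dist_eq]
    rw [add_sub_add_left_eq_sub, ← mul_sub, expectNext_sub, abs_mul, abs_of_nonneg hγ0]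
    refine mul_le_mul_of_nonneg_left (abs_expectNext_le T s a fun s' => ?_) hγ0
    refine abs_iSup_sub_iSup_le fun a' => ?_
    rw [← Real.dist_eq]
    exact (dist_le_pi_dist (q s') (q' s') a').trans (dist_le_pi_dist q q' s')
  refine ⟨hB.fixedPoint, fun s a => ?_⟩
  exact (congrFun (congrFun hB.fixedPoint_isFixedPt s) a).symm

end Bellman

/-! ### Q-learning along a single trajectory -/

section Pathwise

variable {S A : Type*} [DecidableEq S] [Fintype A] [DecidableEq A]
  {γ : ℝ} {r : S → A → ℝ} {X : ℕ → S} {U : ℕ → A} {Y : ℕ → S} {α : ℕ → ℝ} {q : ℕ → S → A → ℝ}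

/-- Q-learning stays bounded once the learning rates are at most `1`. -/
theorem exists_eventually_abs_le [Fintype S] [Nonempty A] (hγ0 : 0 ≤ γ) (hγ1 : γ < 1)
    (hα0 : ∀ n, 0 ≤ α n) (hα1 : ∀ᶠ n in atTop, α n ≤ 1)
    (hq : ∀ n, q (n + 1) = qUpdate γ r (α n) (X n) (U n) (Y n) (q n)) :
    ∃ B, 0 ≤ B ∧ ∀ᶠ n in atTop, ∀ s a, |q n s a| ≤ B := by
  obtain ⟨N, hN⟩ := eventually_atTop.1 hα1
  have h1γ : 0 < 1 - γ := by linarith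
  set C : ℝ := ∑ s, ∑ a, |r s a| with hC
  have hle : ∀ (f : S → A → ℝ) s a, |f s a| ≤ ∑ s, ∑ a, |f s a| := fun f s a =>
    (Finset.single_le_sum (f := fun a => |f s a|) (fun _ _ => abs_nonneg _)
      (Finset.mem_univ a)).trans
    (Finset.single_le_sum (f := fun s => ∑ a, |f s a|)
      (fun _ _ => Finset.sum_nonneg fun _ _ => abs_nonneg _) (Finset.mem_univ s))
  have hC0 : 0 ≤ C := by positivity
  have hB0 : 0 ≤ ∑ s, ∑ a, |q N s a| := by positivity
  -- Any bound on the table at time `N` that also satisfies `C + γ * B ≤ B` is preserved by convex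
  -- updates; adding `C / (1 - γ)` secures this.
  set B : ℝ := (∑ s, ∑ a, |q N s a|) + C / (1 - γ) with hB
  have hBC : C + γ * B ≤ B := by
    have : C = (1 - γ) * (C / (1 - γ)) := by field_simp
    have := mul_nonneg h1γ.le hB0
    nlinarith
  have hBpos : 0 ≤ B := by positivity
  refine ⟨B, hBpos, eventually_atTop.2 ⟨N, fun n hn => ?_⟩⟩
  induction n, hn using Nat.le_induction with
  | base => exact fun s a => (hle (q N) s a).trans (le_add_of_nonneg_right (by positivity))
  | succ n hn ih =>
    intro s a
    rw [hq, qUpdate]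
    split_ifs with h
    · have h1 : 0 ≤ 1 - α n := by linarith [hN n hn]
      have h2 : |r s a + γ * ⨆ a', q n (Y n) a'| ≤ B := by
        refine (abs_add_le _ _).trans (le_trans (add_le_add (hle r s a) ?_) hBC)
        rw [abs_mul, abs_of_nonneg hγ0]
        exact mul_le_mul_of_nonneg_left (abs_iSup_le fun a' => ih _ _) hγ0
      calc |q n s a + α n * ((r s a + γ * ⨆ a', q n (Y n) a') - q n s a)|
          = |(1 - α n) * q n s a + α n * (r s a + γ * ⨆ a', q n (Y n) a')| := by ring_nf
        _ ≤ (1 - α n) * |q n s a| + α n * |r s a + γ * ⨆ a', q n (Y n) a'| := by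
          refine (abs_add_le _ _).trans_eq ?_
          rw [abs_mul, abs_mul, abs_of_nonneg h1, abs_of_nonneg (hα0 n)]
        _ ≤ (1 - α n) * B + α n * B :=
          add_le_add (mul_le_mul_of_nonneg_left (ih s a) h1)
            (mul_le_mul_of_nonneg_left h2 (hα0 n))
        _ = B := by ring
    · exact ih s a

/-- Q-learning converges along every trajectory on which the learning rates are admissible and the
sampling noise has convergent partial sums. -/
theorem tendsto_of_tendsto_noise [Fintype S] [Nonempty A] {T : S → A → PMF S}
    (hγ0 : 0 ≤ γ) (hγ1 : γ < 1) (hα0 : ∀ n, 0 ≤ α n) (hα1 : ∀ᶠ n in atTop, α n ≤ 1)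
    (hq : ∀ n, q (n + 1) = qUpdate γ r (α n) (X n) (U n) (Y n) (q n))
    (hsum : ∀ s a, Tendsto
      (fun N => ∑ n ∈ Finset.range N, if X n = s ∧ U n = a then α n else 0) atTop atTop)
    (hnoise : ∀ s a s', ∃ E, Tendsto (fun N => ∑ n ∈ Finset.range N,
      (if X n = s ∧ U n = a then α n else 0) * (⨆ a', q n s' a') *
        ((if Y n = s' then 1 else 0) - (T s a s').toReal)) atTop (𝓝 E))
    {qstar : S → A → ℝ} (hstar : IsOptimalQ T γ r qstar) (s : S) (a : A) :
    Tendsto (fun n => q n s a) atTop (𝓝 (qstar s a)) := by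
  have step : ∀ D, (∀ᶠ n in atTop, ∀ s a, |q n s a - qstar s a| ≤ D) → ∀ ε > 0,
      ∀ᶠ n in atTop, ∀ s a, |q n s a - qstar s a| ≤ γ * D + ε := by
    intro D hD ε hε
    refine eventually_all.2 fun s => eventually_all.2 fun a => ?_
    choose E hE using hnoise s a
    have hE' := (tendsto_finsetSum Finset.univ fun s' _ => hE s').const_mul γ
    set β : ℕ → ℝ := fun n => if X n = s ∧ U n = a then α n else 0 with hβ
    refine eventually_abs_le_of_noisy_averaging (x := fun n => q n s a - qstar s a) (a := β)
      (f := fun n => γ * expectNext T s a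
        (fun s' => (⨆ a', q n s' a') - ⨆ a', qstar s' a'))
      (e := fun n => γ * ∑ s', β n * (⨆ a', q n s' a') *
        ((if Y n = s' then 1 else 0) - (T s a s').toReal))
      (E := γ * ∑ s', E s') ?_ ?_ (hsum s a) ?_ ?_ ?_ hε
    · intro n; simp only [hβ]; split_ifs; exacts [hα0 n, le_rfl]
    · filter_upwards [hα1] with n hn
      simp only [hβ]; split_ifs; exacts [hn, zero_le_one]
    · intro n
      -- Splitting the noise by successor makes each maximum refer to a fixed state; the indicators
      -- reassemble the sampled value minus its expectation.
      have hs : ∑ s', β n * (⨆ a', q n s' a') *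
          ((if Y n = s' then 1 else 0) - (T s a s').toReal) =
          β n * ((⨆ a', q n (Y n) a') - expectNext T s a fun s' => ⨆ a', q n s' a') := by
        simp only [mul_assoc, ← Finset.mul_sum, mul_sub, Finset.sum_sub_distrib, expectNext]
        simp [mul_comm]
      rw [hs, hq, qUpdate, ← expectNext_sub]
      have hb := hstar s a
      by_cases h : X n = s ∧ U n = a
      · rw [if_pos ⟨h.1.symm, h.2.symm⟩]
        simp only [hβ, if_pos h]
        rw [hb]; ring
      · rw [if_neg fun h' => h ⟨h'.1.symm, h'.2.symm⟩]
        simp only [hβ, if_neg h]; ring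
    · simpa only [← Finset.mul_sum, Finset.sum_comm (s := Finset.range _)] using hE'
    · filter_upwards [hD] with n hn
      rw [abs_mul, abs_of_nonneg hγ0]
      exact mul_le_mul_of_nonneg_left
        (abs_expectNext_le T s a fun s' => abs_iSup_sub_iSup_le fun a' => hn s' a') hγ0
  obtain ⟨B, hB0, hB⟩ := exists_eventually_abs_le hγ0 hγ1 hα0 hα1 hq
  -- The `+ 1` makes `C` positive, so that the slack `(1 - γ) / 2 * (C * κ ^ m)` used below is
  -- positive; `γ + (1 - γ) / 2 = κ`.
  set C : ℝ := B + ∑ s, ∑ a, |qstar s a| + 1 with hC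
  have hCpos : 0 < C := by positivity
  set κ : ℝ := (1 + γ) / 2 with hκ
  have hκ0 : 0 < κ := by simp only [hκ]; linarith
  have hκ1 : κ < 1 := by simp only [hκ]; linarith
  have geom : ∀ m : ℕ, ∀ᶠ n in atTop, ∀ s a, |q n s a - qstar s a| ≤ C * κ ^ m := by
    intro m
    induction m with
    | zero =>
      filter_upwards [hB] with n hn s a
      have h1 : |qstar s a| ≤ ∑ s, ∑ a, |qstar s a| :=
        (Finset.single_le_sum (f := fun a => |qstar s a|) (fun _ _ => abs_nonneg _)
          (Finset.mem_univ a)).trans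
        (Finset.single_le_sum (f := fun s => ∑ a, |qstar s a|)
          (fun _ _ => Finset.sum_nonneg fun _ _ => abs_nonneg _) (Finset.mem_univ s))
      have h2 := hn s a
      refine (abs_sub _ _).trans ?_
      simp only [pow_zero, mul_one, hC]; linarith
    | succ m ih =>
      have hpos : 0 < C * κ ^ m := by positivity
      have := step _ ih ((1 - γ) / 2 * (C * κ ^ m)) (mul_pos (by linarith) hpos)
      filter_upwards [this] with n hn s a
      refine (hn s a).trans_eq ?_
      rw [pow_succ]; simp only [hκ]; ring
  rw [Metric.tendsto_nhds]
  intro ε hε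
  have hlim : Tendsto (fun m : ℕ => C * κ ^ m) atTop (𝓝 0) := by
    simpa using (tendsto_pow_atTop_nhds_zero_of_lt_one hκ0.le hκ1).const_mul C
  obtain ⟨m, hm⟩ := (hlim.eventually (gt_mem_nhds hε)).exists
  filter_upwards [geom m] with n hn
  rw [Real.dist_eq]
  exact (hn s a).trans_lt hm

end Pathwise

/-! ### Convergence of martingale transforms -/

section Martingale

variable {Ω : Type*} {mΩ : MeasurableSpace Ω} {μ : Measure Ω} [IsProbabilityMeasure μ]
  {ℱ : Filtration ℕ mΩ} {c ξ : ℕ → Ω → ℝ}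

/-- A transform of bounded martingale differences converges almost surely if the squares of its
coefficients have bounded sum. -/
theorem ae_exists_tendsto_transform_of_bounded
    (hc : ∀ n, Measurable[ℱ n] (c n)) (hξ : ∀ n, Measurable[ℱ (n + 1)] (ξ n))
    (hξ1 : ∀ n ω, |ξ n ω| ≤ 1) (hξ0 : ∀ n, μ[ξ n | ℱ n] =ᵐ[μ] 0) {K : ℝ}
    (hK : ∀ n ω, ∑ k ∈ Finset.range n, c k ω ^ 2 ≤ K) :
    ∀ᵐ ω ∂μ, ∃ E, Tendsto (fun n => ∑ k ∈ Finset.range n, c k ω * ξ k ω) atTop (𝓝 E) := by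
  set M : ℕ → Ω → ℝ := fun n ω => ∑ k ∈ Finset.range n, c k ω * ξ k ω with hM
  have hcb : ∀ n ω, |c n ω| ≤ K + 1 := by
    intro n ω
    have h1 := hK (n + 1) ω
    rw [Finset.sum_range_succ] at h1
    have h2 : 0 ≤ ∑ k ∈ Finset.range n, c k ω ^ 2 := Finset.sum_nonneg fun _ _ => sq_nonneg _
    have h3 := sq_abs (c n ω)
    nlinarith [sq_nonneg (|c n ω| - 1), abs_nonneg (c n ω)]
  have hcξ : ∀ n ω, |c n ω * ξ n ω| ≤ K + 1 := fun n ω => by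
    rw [abs_mul]
    exact (mul_le_of_le_one_right (abs_nonneg _) (hξ1 n ω)).trans (hcb n ω)
  have hMb : ∀ n ω, |M n ω| ≤ n * (K + 1) := fun n ω => by
    refine (Finset.abs_sum_le_sum_abs _ _).trans
      ((Finset.sum_le_sum fun k _ => hcξ k ω).trans_eq ?_)
    rw [Finset.sum_const, Finset.card_range, nsmul_eq_mul]
  have hMm : ∀ n, Measurable[ℱ n] (M n) := fun n => by
    refine Finset.measurable_fun_sum _ fun k hk => ?_
    have hk' := Finset.mem_range.1 hk
    exact ((hc k).mono (ℱ.mono hk'.le) le_rfl).mul ((hξ k).mono (ℱ.mono hk') le_rfl)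
  have hc' : ∀ n, Measurable (c n) := fun n => (hc n).mono (ℱ.le n) le_rfl
  have hξ' : ∀ n, Measurable (ξ n) := fun n => (hξ n).mono (ℱ.le _) le_rfl
  have hM' : ∀ n, Measurable (M n) := fun n => (hMm n).mono (ℱ.le n) le_rfl
  have hint : ∀ {f : Ω → ℝ} {C : ℝ}, Measurable f → (∀ ω, |f ω| ≤ C) → Integrable f μ :=
    fun hf hC => Integrable.of_bound hf.aestronglyMeasurable _ (ae_of_all _ hC)
  have hξi : ∀ n, Integrable (ξ n) μ := fun n => hint (hξ' n) (hξ1 n)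
  have hMi : ∀ n, Integrable (M n) μ := fun n => hint (hM' n) (hMb n)
  have hsucc : ∀ n ω, M (n + 1) ω = M n ω + c n ω * ξ n ω := fun n ω =>
    Finset.sum_range_succ _ _
  have hmart : Martingale M ℱ μ := by
    refine martingale_of_condExp_sub_eq_zero_nat (fun n => (hMm n).stronglyMeasurable) hMi
      fun n => ?_
    have h1 : M (n + 1) - M n = c n * ξ n := by
      ext ω; simp [hsucc]
    rw [h1]
    refine (condExp_stronglyMeasurable_mul_of_bound (ℱ.le n) (hc n).stronglyMeasurable (hξi n)
      (K + 1) (ae_of_all _ (hcb n))).trans ?_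
    filter_upwards [hξ0 n] with ω hω
    simp [hω]
  -- `M n * c n` is bounded and known at time `n`, so conditioning on `ℱ n` removes the cross term.
  -- The second moment then grows by at most that of `c n`.
  have hcross : ∀ n, ∫ ω, M n ω * c n ω * ξ n ω ∂μ = 0 := by
    intro n
    have hb : ∀ ω, |(M n * c n) ω| ≤ n * (K + 1) * (K + 1) := fun ω => by
      rw [Pi.mul_apply, abs_mul]
      exact mul_le_mul (hMb n ω) (hcb n ω) (abs_nonneg _) ((abs_nonneg _).trans (hMb n ω))
    have h1 := condExp_stronglyMeasurable_mul_of_bound (μ := μ) (ℱ.le n)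
      ((hMm n).mul (hc n)).stronglyMeasurable (hξi n) _ (ae_of_all _ hb)
    have h2 : μ[M n * c n * ξ n | ℱ n] =ᵐ[μ] 0 := h1.trans <| by
      filter_upwards [hξ0 n] with ω hω
      simp [hω]
    have h3 := integral_condExp (μ := μ) (f := M n * c n * ξ n) (ℱ.le n)
    rw [integral_congr_ae h2] at h3
    simpa using h3.symm
  have hc2 : ∀ n, Integrable (fun ω => c n ω ^ 2) μ := fun n =>
    hint (C := (K + 1) ^ 2) ((hc' n).pow_const 2) fun ω => by
      rw [abs_pow]; exact pow_le_pow_left₀ (abs_nonneg _) (hcb n ω) 2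
  have hM2 : ∀ n, Integrable (fun ω => M n ω ^ 2) μ := fun n =>
    hint (C := (n * (K + 1)) ^ 2) ((hM' n).pow_const 2) fun ω => by
      rw [abs_pow]; exact pow_le_pow_left₀ (abs_nonneg _) (hMb n ω) 2
  have henergy : ∀ n, ∫ ω, M n ω ^ 2 ∂μ ≤ ∑ k ∈ Finset.range n, ∫ ω, c k ω ^ 2 ∂μ := by
    intro n
    induction n with
    | zero => simp [hM]
    | succ n ih =>
      have hcr : Integrable (fun ω => 2 * (M n ω * c n ω * ξ n ω)) μ :=
        (hint (C := n * (K + 1) * (K + 1)) (((hM' n).mul (hc' n)).mul (hξ' n)) fun ω => by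
          rw [Pi.mul_apply, Pi.mul_apply, mul_assoc, abs_mul]
          exact mul_le_mul (hMb n ω) (hcξ n ω) (abs_nonneg _)
            ((abs_nonneg _).trans (hMb n ω))).const_mul 2
      rw [Finset.sum_range_succ]
      calc ∫ ω, M (n + 1) ω ^ 2 ∂μ
          ≤ ∫ ω, (M n ω ^ 2 + 2 * (M n ω * c n ω * ξ n ω) + c n ω ^ 2) ∂μ := by
            refine integral_mono (hM2 _) (((hM2 n).add hcr).add (hc2 n)) fun ω => ?_
            have h1 : ξ n ω ^ 2 ≤ 1 := (sq_le_one_iff_abs_le_one _).2 (hξ1 n ω)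
            have h2 := mul_le_mul_of_nonneg_left h1 (sq_nonneg (c n ω))
            beta_reduce
            rw [hsucc]
            nlinarith
        _ = ∫ ω, M n ω ^ 2 ∂μ + ∫ ω, c n ω ^ 2 ∂μ := by
            rw [integral_add (by exact (hM2 n).add hcr) (hc2 n), integral_add (hM2 n) hcr,
              integral_const_mul, hcross, mul_zero, add_zero]
        _ ≤ _ := by gcongr
  have hbound : ∀ n, ∫ ω, M n ω ^ 2 ∂μ ≤ K := fun n => by
    refine (henergy n).trans ?_
    rw [← integral_finsetSum _ fun k _ => hc2 k]
    refine (integral_mono (integrable_finsetSum _ fun k _ => hc2 k) (integrable_const K)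
      fun ω => hK n ω).trans_eq ?_
    simp
  -- Doob's convergence theorem needs an L¹ bound, which follows from `|x| ≤ 1 + x ^ 2`.
  have hL1 : ∀ n, eLpNorm (M n) 1 μ ≤ (Real.toNNReal (1 + K) : ENNReal) := fun n => by
    rw [eLpNorm_one_eq_lintegral_enorm, ← ofReal_integral_norm_eq_lintegral_enorm (hMi n)]
    refine ENNReal.ofReal_le_ofReal ?_
    calc ∫ ω, ‖M n ω‖ ∂μ ≤ ∫ ω, (1 + M n ω ^ 2) ∂μ := by
          refine integral_mono (hMi n).norm ((integrable_const 1).add (hM2 n)) fun ω => ?_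
          have := sq_abs (M n ω)
          simp only [Real.norm_eq_abs]
          nlinarith [sq_nonneg (|M n ω| - 1)]
      _ = 1 + ∫ ω, M n ω ^ 2 ∂μ := by
          rw [integral_add (integrable_const 1) (hM2 n)]; simp
      _ ≤ 1 + K := by linarith [hbound n]
  filter_upwards [hmart.submartingale.ae_tendsto_limitProcess hL1] with ω hω
  exact ⟨_, hω⟩

/-- A transform of bounded martingale differences converges almost surely on the event that the
squares of its coefficients are summable. -/
theorem ae_exists_tendsto_transform
    (hc : ∀ n, Measurable[ℱ n] (c n)) (hξ : ∀ n, Measurable[ℱ (n + 1)] (ξ n))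
    (hξ1 : ∀ n ω, |ξ n ω| ≤ 1) (hξ0 : ∀ n, μ[ξ n | ℱ n] =ᵐ[μ] 0) :
    ∀ᵐ ω ∂μ, (Summable fun n => c n ω ^ 2) →
      ∃ E, Tendsto (fun n => ∑ k ∈ Finset.range n, c k ω * ξ k ω) atTop (𝓝 E) := by
  classical
  -- The sum includes index `n`: `c n` is already `ℱ n`-measurable, so stopping before the sum
  -- exceeds `K` keeps the coefficients adapted and their squares summing to at most `K`.
  set σ : ℕ → Ω → ℝ := fun n ω => ∑ k ∈ Finset.range (n + 1), c k ω ^ 2 with hσ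
  set d : ℕ → ℕ → Ω → ℝ := fun K n ω => if σ n ω ≤ K then c n ω else 0 with hd
  have hσm : ∀ n, Measurable[ℱ n] (σ n) := fun n => by
    refine Finset.measurable_fun_sum _ fun k hk => ?_
    have hk' := Nat.lt_succ_iff.1 (Finset.mem_range.1 hk)
    exact ((hc k).mono (ℱ.mono hk') le_rfl).pow_const 2
  have hdm : ∀ K n, Measurable[ℱ n] (d K n) := fun K n =>
    Measurable.ite (measurableSet_le (hσm n) measurable_const) (hc n) measurable_const
  have hdK : ∀ (K : ℕ) n ω, ∑ k ∈ Finset.range n, d K k ω ^ 2 ≤ K := by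
    intro K n ω
    induction n with
    | zero => simp
    | succ n ih =>
      by_cases h : σ n ω ≤ K
      · refine le_trans (Finset.sum_le_sum fun k _ => ?_) h
        simp only [hd]
        split_ifs
        · exact le_rfl
        · simpa using sq_nonneg (c k ω)
      · rw [Finset.sum_range_succ]
        simpa [hd, h] using ih
  filter_upwards [ae_all_iff.2 fun K => ae_exists_tendsto_transform_of_bounded
    (hdm K) hξ hξ1 hξ0 (hdK K)] with ω hω hs
  obtain ⟨K, hK⟩ := exists_nat_ge (∑' n, c n ω ^ 2)
  obtain ⟨E, hE⟩ := hω K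
  refine ⟨E, hE.congr fun n => Finset.sum_congr rfl fun k _ => ?_⟩
  have : σ k ω ≤ K := (hs.sum_le_tsum _ fun _ _ => sq_nonneg _).trans hK
  simp only [hd, if_pos this]

end Martingale

/-! ### Almost sure convergence of Q-learning -/

/-- State and action types carry no σ-algebra here, so tables read at a random index are handled by
partitioning over its countably many values. -/
theorem measurable_eval {Ω S : Type*} {m : MeasurableSpace Ω} [Countable S] {Z : Ω → S}
    (hZ : ∀ s, MeasurableSet {ω | Z ω = s}) {f : S → Ω → ℝ} (hf : ∀ s, Measurable (f s)) :
    Measurable fun ω => f (Z ω) ω := by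
  intro B hB
  have : (fun ω => f (Z ω) ω) ⁻¹' B = ⋃ s, {ω | Z ω = s} ∩ f s ⁻¹' B := by
    ext ω; simp
  rw [this]
  exact MeasurableSet.iUnion fun s => (hZ s).inter (hf s hB)

section QLearning

variable {Ω S A : Type*} [Fintype S] [DecidableEq S] [Fintype A]
  {T : S → A → PMF S} {γ : ℝ} {mΩ : MeasurableSpace Ω} {μ : Measure Ω}
  {ℱ : Filtration ℕ mΩ} {X : ℕ → Ω → S} {U : ℕ → Ω → A} {Y : ℕ → Ω → S} {α : ℕ → Ω → ℝ}

theorem measurable_qLearn [DecidableEq A] (hexp : IsExperience μ ℱ T X U Y)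
    (hα : ∀ n, Measurable[ℱ n] (α n)) (r q₀ : S → A → ℝ) (n : ℕ) (s : S) (a : A) :
    Measurable[ℱ n] fun ω => qLearn γ X U Y α r q₀ n ω s a := by
  induction n generalizing s a with
  | zero => exact measurable_const
  | succ n ih =>
    have hle : ℱ n ≤ ℱ (n + 1) := ℱ.mono n.le_succ
    have hq : ∀ s a, Measurable[ℱ (n + 1)] fun ω => qLearn γ X U Y α r q₀ n ω s a :=
      fun s a => (ih s a).mono hle le_rfl
    have hmax : Measurable[ℱ (n + 1)] fun ω => ⨆ a', qLearn γ X U Y α r q₀ n ω (Y n ω) a' :=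
      measurable_eval (m := ℱ (n + 1)) (f := fun s' ω => ⨆ a', qLearn γ X U Y α r q₀ n ω s' a')
        (hexp.next_adapted n) fun s' => Measurable.iSup fun a' => hq s' a'
    have hset : MeasurableSet[ℱ (n + 1)] {ω | s = X n ω ∧ a = U n ω} := by
      simp only [eq_comm (a := s), eq_comm (a := a)]
      exact (hle _ (hexp.state_adapted n s)).inter (hle _ (hexp.action_adapted n a))
    exact Measurable.ite hset
      ((hq s a).add (((hα n).mono hle le_rfl).mul
        ((measurable_const.add (hmax.const_mul γ)).sub (hq s a)))) (hq s a)

/-- The sampling noise of Q-learning has almost surely convergent partial sums. -/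
theorem ae_exists_tendsto_noise [IsProbabilityMeasure μ] (hexp : IsExperience μ ℱ T X U Y)
    {c : ℕ → Ω → ℝ} (hc : ∀ n, Measurable[ℱ n] (c n)) (s' : S) :
    ∀ᵐ ω ∂μ, (Summable fun n => c n ω ^ 2) →
      ∃ E, Tendsto (fun N => ∑ n ∈ Finset.range N, c n ω *
        ((if Y n ω = s' then 1 else 0) - (T (X n ω) (U n ω) s').toReal)) atTop (𝓝 E) := by
  have hT : ∀ n, Measurable[ℱ n] fun ω => (T (X n ω) (U n ω) s').toReal := fun n =>
    measurable_eval (m := ℱ n) (f := fun s ω => (T s (U n ω) s').toReal) (hexp.state_adapted n)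
      fun s => measurable_eval (m := ℱ n) (f := fun a _ => (T s a s').toReal)
        (hexp.action_adapted n) fun a => measurable_const
  have hT0 : ∀ n ω, 0 ≤ (T (X n ω) (U n ω) s').toReal := fun _ _ => ENNReal.toReal_nonneg
  have hT1 : ∀ n ω, (T (X n ω) (U n ω) s').toReal ≤ 1 := fun n ω =>
    ENNReal.toReal_le_of_le_ofReal zero_le_one (by simpa using PMF.coe_le_one _ _)
  have hY : ∀ n, Measurable[ℱ (n + 1)] fun ω => if Y n ω = s' then (1 : ℝ) else 0 := fun n =>
    Measurable.ite (hexp.next_adapted n s') measurable_const measurable_const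
  refine ae_exists_tendsto_transform (ℱ := ℱ) hc
    (fun n => (hY n).sub ((hT n).mono (ℱ.mono n.le_succ) le_rfl)) (fun n ω => ?_) fun n => ?_
  · have h0 := hT0 n ω
    have h1 := hT1 n ω
    split_ifs <;> exact abs_le.2 ⟨by linarith, by linarith⟩
  · have hYi : Integrable (fun ω => if Y n ω = s' then (1 : ℝ) else 0) μ := by
      refine Integrable.of_bound ((hY n).mono (ℱ.le _) le_rfl).aestronglyMeasurable 1
        (ae_of_all _ fun ω => ?_)
      split_ifs <;> simp
    have hTi : Integrable (fun ω => (T (X n ω) (U n ω) s').toReal) μ := by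
      refine Integrable.of_bound ((hT n).mono (ℱ.le _) le_rfl).aestronglyMeasurable 1
        (ae_of_all _ fun ω => ?_)
      rw [Real.norm_of_nonneg (hT0 n ω)]
      exact hT1 n ω
    have hind : (fun ω => if Y n ω = s' then (1 : ℝ) else 0) =
        {ω | Y n ω = s'}.indicator fun _ => (1 : ℝ) := by
      ext ω; simp [Set.indicator_apply]
    refine (condExp_sub hYi hTi (ℱ n)).trans ?_
    rw [condExp_of_stronglyMeasurable (ℱ.le n) (hT n).stronglyMeasurable hTi, hind]
    filter_upwards [hexp.transition n s'] with ω hω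
    simp [hω]

/-- Tabular Q-learning converges almost surely to the optimal Q-function. -/
theorem ae_tendsto_qLearn [DecidableEq A] [Nonempty A] [IsProbabilityMeasure μ] (hγ0 : 0 ≤ γ) (hγ1 : γ < 1)
    (hexp : IsExperience μ ℱ T X U Y) (hα : IsLearningRate μ ℱ X U α) {r qstar : S → A → ℝ}
    (hstar : IsOptimalQ T γ r qstar) (q₀ : S → A → ℝ) :
    ∀ᵐ ω ∂μ, ∀ s a, Tendsto (fun n => qLearn γ X U Y α r q₀ n ω s a) atTop (𝓝 (qstar s a)) := by
  set q := qLearn γ X U Y α r q₀ with hq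
  set β : S → A → ℕ → Ω → ℝ := fun s a n ω => if X n ω = s ∧ U n ω = a then α n ω else 0 with hβ
  set c : S → A → S → ℕ → Ω → ℝ := fun s a s' n ω => β s a n ω * ⨆ a', q n ω s' a' with hcdef
  have hc : ∀ s a s' n, Measurable[ℱ n] (c s a s' n) := fun s a s' n =>
    (Measurable.ite ((hexp.state_adapted n s).inter (hexp.action_adapted n a)) (hα.adapted n)
      measurable_const).mul
      (Measurable.iSup fun a' => measurable_qLearn hexp hα.adapted r q₀ n s' a')
  filter_upwards [hα.sum_infinite, hα.sum_sq_finite,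
    ae_all_iff.2 fun s => ae_all_iff.2 fun a => ae_all_iff.2 fun s' =>
      ae_exists_tendsto_noise hexp (hc s a s') s'] with ω hsum hsq hnoise
  have hα0 : ∀ n, 0 ≤ α n ω := fun n => hα.nonneg n ω
  -- Every step visits some pair, and along each of the finitely many pairs the squared rates tend
  -- to zero.
  have hα1 : ∀ᶠ n in atTop, α n ω ≤ 1 := by
    have h : ∀ᶠ n in atTop, ∀ s a, (if X n ω = s ∧ U n ω = a then α n ω ^ 2 else 0) < 1 :=
      eventually_all.2 fun s => eventually_all.2 fun a =>
        (hsq s a).tendsto_atTop_zero.eventually (gt_mem_nhds one_pos)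
    filter_upwards [h] with n hn
    have := hn (X n ω) (U n ω)
    rw [if_pos ⟨rfl, rfl⟩] at this
    nlinarith [hα0 n]
  have hstep : ∀ n, q (n + 1) ω = qUpdate γ r (α n ω) (X n ω) (U n ω) (Y n ω) (q n ω) :=
    fun n => rfl
  obtain ⟨B, hB0, hB⟩ := exists_eventually_abs_le (q := fun n => q n ω) hγ0 hγ1 hα0 hα1 hstep
  -- The bound `B` depends on the path, which is why the noise lemma is stated on the event of
  -- summability.
  have hsummable : ∀ s a s', Summable fun n => c s a s' n ω ^ 2 := by
    intro s a s'
    refine Summable.of_norm_bounded_eventually_nat ((hsq s a).mul_right (B ^ 2)) ?_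
    filter_upwards [hB] with n hn
    have h1 : (⨆ a', q n ω s' a') ^ 2 ≤ B ^ 2 := by
      rw [← sq_abs]
      exact pow_le_pow_left₀ (abs_nonneg _) (abs_iSup_le fun a' => hn s' a') 2
    rw [Real.norm_of_nonneg (sq_nonneg _)]
    simp only [hcdef, hβ]
    split_ifs
    · rw [mul_pow]; gcongr
    · simp
  refine fun s a => tendsto_of_tendsto_noise (q := fun n => q n ω) hγ0 hγ1 hα0 hα1 hstep hsum
    (fun s a s' => ?_) hstar s a
  obtain ⟨E, hE⟩ := hnoise s a s' (hsummable s a s')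
  refine ⟨E, hE.congr fun N => Finset.sum_congr rfl fun n _ => ?_⟩
  -- The law at the visited pair may be replaced by `T s a`, since the coefficient vanishes off
  -- visits to `(s, a)`.
  by_cases h : X n ω = s ∧ U n ω = a
  · simp only [hcdef, hβ, h.1, h.2]
  · simp only [hcdef, hβ, if_neg h, zero_mul]

end QLearning

end AUP

theorem mainTheorem2
    {S A ι : Type*} [Fintype S] [DecidableEq S] [Fintype A] [DecidableEq A] [Fintype ι]
    (T : S → A → PMF S) (noop : A) (R : S → A → ℝ) (γ : ℝ) (hγ0 : 0 ≤ γ) (hγ1 : γ < 1)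
    (Raux : ι → S → A → ℝ) (lam : ℝ) (hlam : 0 ≤ lam)
    {Ω : Type*} {mΩ : MeasurableSpace Ω} (μ : Measure Ω) [IsProbabilityMeasure μ]
    (ℱ : Filtration ℕ mΩ)
    (X : ℕ → Ω → S) (U : ℕ → Ω → A) (Y : ℕ → Ω → S) (α : ℕ → Ω → ℝ)
    (hexp : AUP.IsExperience μ ℱ T X U Y)
    (hvisit : AUP.ExploresInfinitely μ X U)
    (hα : AUP.IsLearningRate μ ℱ X U α)
    (Q₀ : ι → S → A → ℝ)
    (Q : ℕ → Ω → ι → S → A → ℝ)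
    (hQ : Q = fun n ω i => AUP.qLearn γ X U Y α (Raux i) (Q₀ i) n ω)
    (scale : (ι → S → A → ℝ) → S → ℝ) (scaleLim : Ω → S → ℝ)
    (hscale : ∀ᵐ ω ∂μ, ∀ s, 0 < scaleLim ω s ∧
      Tendsto (fun n => scale (Q n ω) s) atTop (𝓝 (scaleLim ω s))) :
    ∃ Qstar : ι → S → A → ℝ, (∀ i, AUP.IsOptimalQ T γ (Raux i) (Qstar i)) ∧
      ∀ᵐ ω ∂μ, ∀ s a,
        Tendsto (fun n => AUP.rAUP noop R lam scale (Q n ω) s a) atTop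
          (𝓝 (R s a - lam * (AUP.penalty noop Qstar s a / scaleLim ω s))) := by
  have : Nonempty A := ⟨noop⟩
  choose Qstar hQstar using fun i => AUP.exists_isOptimalQ T hγ0 hγ1 (Raux i)
  refine ⟨Qstar, hQstar, ?_⟩
  filter_upwards [hscale, ae_all_iff.2 fun i =>
    AUP.ae_tendsto_qLearn hγ0 hγ1 hexp hα (hQstar i) (Q₀ i)] with ω hsc hconv s a
  have hQconv : ∀ i s a, Tendsto (fun n => Q n ω i s a) atTop (𝓝 (Qstar i s a)) := by
    subst hQ
    exact hconv
  have hpen : Tendsto (fun n => AUP.penalty noop (Q n ω) s a) atTop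
      (𝓝 (AUP.penalty noop Qstar s a)) :=
    tendsto_finsetSum _ fun i _ => ((hQconv i s a).sub (hQconv i s noop)).abs
  exact tendsto_const_nhds.sub ((hpen.div (hsc s).2 (hsc s).1.ne').const_mul lam)
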